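/- Let $0\le k\le n$, let $n_1,\dots,n_k\in\mathbb{R}^n$ be linearly independent unit vectors, let $W=\mathrm{span}\{n_1,\dots,n_k\}$, let $N=W^{\perp}$ be its orthogonal complement, an $(n-k)$-dimensional Euclidean space, and let $P_N$ denote the orthogonal projection onto $N$. Let $C=[-1,1]^n$, and choose $\tau\in N$ uniformly, with respect to $(n-k)$-dimensional Lebesgue measure, from $P_N(C)$, which is the set of $\tau\in N$ for which the flat $\tau+W$ meets $C$. Then the slice $C\cap(\tau+W)$ has finitely many vertices (extreme points) for every $\tau\in N$, the number of its vertices is an integrable random variable, and its expected value is exactly $2^k$: $$\mathbb{E}\,\#\,\mathrm{vert}\bigl(C\cap(\tau+W)\bigr)=2^k ,$$ whatever $n$ is. The same holds when $C$ is replaced throughout by an arbitrary $n$-dimensional parallelotope $\{a+\sum_{i=1}^n t_i w_i : t_i\in[0,1]\}$, where $a\in\mathbb{R}^n$ and $w_1,\dots,w_n\in\mathbb{R}^n$ are linearly independent. -/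

import Mathlib

open MeasureTheory

/-- The hypercube `[-1, 1]^n` in Euclidean space. -/
def cube (n : ℕ) : Set (EuclideanSpace ℝ (Fin n)) :=
  {x | ∀ i, x i ∈ Set.Icc (-1 : ℝ) 1}

/-- The parallelotope `{a + ∑ i, t i • w i | t i ∈ [0, 1]}` with corner `a` and edge vectors `w`;
it is a genuine `n`-dimensional parallelotope when `w` is linearly independent. -/
def parallelotope {n : ℕ} (a : EuclideanSpace ℝ (Fin n))
    (w : Fin n → EuclideanSpace ℝ (Fin n)) : Set (EuclideanSpace ℝ (Fin n)) :=
  (fun x => a + x) '' parallelepiped w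

/-- The slice `C ∩ (τ + W)` of `C` by the flat through `τ` with direction `W`. -/
def slice {n : ℕ} (C : Set (EuclideanSpace ℝ (Fin n)))
    (W : Submodule ℝ (EuclideanSpace ℝ (Fin n))) (τ : EuclideanSpace ℝ (Fin n)) :
    Set (EuclideanSpace ℝ (Fin n)) :=
  C ∩ (AffineSubspace.mk' τ W : Set (EuclideanSpace ℝ (Fin n)))

/-- The vertices of the slice `C ∩ (τ + W)`, i.e. its extreme points. -/
def sliceVertices {n : ℕ} (C : Set (EuclideanSpace ℝ (Fin n)))
    (W : Submodule ℝ (EuclideanSpace ℝ (Fin n))) (τ : EuclideanSpace ℝ (Fin n)) :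
    Set (EuclideanSpace ℝ (Fin n)) :=
  (slice C W τ).extremePoints ℝ

/-- The uniform distribution on the set `P_N(C)` of translations, where `N = Wᗮ` is the orthogonal
complement of the direction `W` and `P_N` is the orthogonal projection onto `N`. Here `volume` is
the Lebesgue measure of the Euclidean space `N` itself, of dimension `dim N`. -/
noncomputable def translationLaw {n : ℕ} (C : Set (EuclideanSpace ℝ (Fin n)))
    (W : Submodule ℝ (EuclideanSpace ℝ (Fin n))) : Measure Wᗮ :=
  ProbabilityTheory.cond (volume : Measure Wᗮ) (Wᗮ.orthogonalProjectionOnto '' C)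

/-! Write the parallelotope as an affine image of `[0,1]^n` and let `a i` be the projections of its
edge vectors to `N`. Up to translation, slices are injective affine images of the fibres of `t ↦ ∑
i, t i • a i` on the cube, and `τ` is uniform on the zonotope `Z` that is the image of the cube.

A point of a fibre is a vertex iff the `a i` at its coordinates in `(0,1)` are independent
(`mem_extremePoints_cubeFiber_iff`). For almost every `y` these `a i` form a basis, so the vertices
over `y` correspond to the pairs of a basis `S` and a 0/1 pattern off `S` whose open cell in `Z`
contains `y` (`IsCubeGeneric.ncard_extremePoints`).

The `2 ^ k` cells of one basis are translates of each other, hence equally likely. A generic linear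
functional picks one cell per basis, namely the one where it is maximal on fibres; these cells tile
`Z` up to a null set (`exists_tiling`), so their probabilities sum to 1. The expectation is
therefore `2 ^ k`. -/

section Combinatorics

/-! ### Faces of the unit cube and vertices of its linear fibres. -/

open scoped Classical in
/-- The coordinates of `t` lying strictly between `0` and `1`. -/
noncomputable def freeCoords {ι : Type*} [Fintype ι] (t : ι → ℝ) : Finset ι :=
  Finset.univ.filter fun i => t i ∈ Set.Ioo (0 : ℝ) 1

open scoped Classical in
/-- The coordinates of `t` equal to `1`. -/
noncomputable def topCoords {ι : Type*} [Fintype ι] (t : ι → ℝ) : Finset ι :=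
  Finset.univ.filter fun i => t i = 1

/-- The relatively open face of the unit cube with free coordinates `S` whose remaining
coordinates are `1` on `U` and `0` off `U`. -/
def openFace {ι : Type*} (S U : Finset ι) : Set (ι → ℝ) :=
  {t | (∀ i ∈ S, t i ∈ Set.Ioo (0 : ℝ) 1) ∧ (∀ i ∉ S, i ∈ U → t i = 1) ∧
    ∀ i ∉ S, i ∉ U → t i = 0}

variable {ι N : Type*} [Fintype ι] [AddCommGroup N] [Module ℝ N]

/-- The part of the unit cube mapped to `y` by `t ↦ ∑ i, t i • a i`. -/
def cubeFiber (a : ι → N) (y : N) : Set (ι → ℝ) :=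
  {t | t ∈ Set.Icc 0 1 ∧ Fintype.linearCombination ℝ a t = y}

/-- The image of an open face of the unit cube under `t ↦ ∑ i, t i • a i`. -/
def openCell (a : ι → N) (S U : Finset ι) : Set N :=
  Fintype.linearCombination ℝ a '' openFace S U

/-- `S` indexes a basis among the vectors `a`. -/
def IsBasisIndex (a : ι → N) (S : Finset ι) : Prop :=
  LinearIndepOn ℝ a (S : Set ι) ∧ Submodule.span ℝ (a '' S) = ⊤

open scoped Classical in
/-- The finset of all index sets of bases among the vectors `a`. -/
noncomputable def basisIndices (a : ι → N) : Finset (Finset ι) :=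
  Finset.univ.filter (IsBasisIndex a)

/-- The point `y` lies on no image of a face of the unit cube spanning a proper subspace. -/
def IsCubeGeneric (a : ι → N) (y : N) : Prop :=
  ∀ T U : Finset ι, Submodule.span ℝ (a '' T) ≠ ⊤ →
    y - ∑ i ∈ U, a i ∉ Submodule.span ℝ (a '' T)

theorem mem_openFace_coords {t : ι → ℝ} (ht : t ∈ Set.Icc 0 1) :
    t ∈ openFace (freeCoords t) (topCoords t) := by
  refine ⟨fun i hi => by simpa [freeCoords] using hi, fun i _ hi => by simpa [topCoords] using hi,
    fun i hi hi' => ?_⟩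
  have h0 := ht.1 i
  have h1 := ht.2 i
  simp only [freeCoords, topCoords, Finset.mem_filter, Finset.mem_univ, true_and, Set.mem_Ioo,
    not_and, not_lt, Pi.zero_apply, Pi.one_apply] at hi hi' h0 h1
  by_contra h
  exact hi' (le_antisymm h1 (hi (lt_of_le_of_ne h0 (Ne.symm h))))

theorem openFace_subset_Icc {ι : Type*} (S U : Finset ι) : openFace S U ⊆ Set.Icc 0 1 := by
  rintro t ⟨h1, h2, h3⟩
  have key : ∀ i, 0 ≤ t i ∧ t i ≤ 1 := fun i => by
    by_cases hS : i ∈ S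
    · exact ⟨(h1 i hS).1.le, (h1 i hS).2.le⟩
    · by_cases hU : i ∈ U
      · simp [h2 i hS hU]
      · simp [h3 i hS hU]
  exact ⟨fun i => (key i).1, fun i => (key i).2⟩

theorem freeCoords_eq_of_mem_openFace {S U : Finset ι} {t : ι → ℝ} (ht : t ∈ openFace S U) :
    freeCoords t = S := by
  ext i
  simp only [freeCoords, Finset.mem_filter, Finset.mem_univ, true_and]
  refine ⟨fun h => ?_, ht.1 i⟩
  by_contra hS
  by_cases hU : i ∈ U
  · simp [ht.2.1 i hS hU] at h
  · simp [ht.2.2 i hS hU] at h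

theorem topCoords_eq_of_mem_openFace {S U : Finset ι} (hU : Disjoint S U) {t : ι → ℝ}
    (ht : t ∈ openFace S U) : topCoords t = U := by
  ext i
  simp only [topCoords, Finset.mem_filter, Finset.mem_univ, true_and]
  refine ⟨fun h => ?_, fun h => ht.2.1 i (Finset.disjoint_right.1 hU h) h⟩
  by_contra hi
  by_cases hS : i ∈ S
  · exact (ht.1 i hS).2.ne h
  · simp [ht.2.2 i hS hi] at h

theorem disjoint_freeCoords_topCoords (t : ι → ℝ) : Disjoint (freeCoords t) (topCoords t) := by
  rw [Finset.disjoint_left]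
  intro i hi hi'
  simp only [freeCoords, topCoords, Finset.mem_filter, Finset.mem_univ, true_and] at hi hi'
  exact hi.2.ne hi'

theorem linearIndepOn_iff_linearCombination_eq_zero {a : ι → N} {S : Finset ι} :
    LinearIndepOn ℝ a (S : Set ι) ↔ ∀ g : ι → ℝ, (∀ i ∉ S, g i = 0) →
      Fintype.linearCombination ℝ a g = 0 → g = 0 := by
  rw [linearIndepOn_finset_iff]
  constructor
  · intro h g hg h0
    rw [Fintype.linearCombination_apply,
      ← Finset.sum_subset S.subset_univ fun i _ hi => by simp [hg i hi]] at h0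
    funext i
    by_cases hi : i ∈ S
    · exact h g h0 i hi
    · exact hg i hi
  · intro h g h0 i hi
    classical
    have := h (fun i => if i ∈ S then g i else 0) (fun i hi => by simp [hi]) (by
      rw [Fintype.linearCombination_apply,
        ← Finset.sum_subset S.subset_univ fun i _ hi => by simp [hi], ← h0]
      exact Finset.sum_congr rfl fun i hi => by simp [hi])
    simpa [hi] using congrFun this i

theorem eq_of_mem_openFace {a : ι → N} {S U : Finset ι} (hS : LinearIndepOn ℝ a (S : Set ι))
    {t t' : ι → ℝ} (ht : t ∈ openFace S U) (ht' : t' ∈ openFace S U)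
    (h : Fintype.linearCombination ℝ a t = Fintype.linearCombination ℝ a t') : t = t' := by
  refine sub_eq_zero.1 (linearIndepOn_iff_linearCombination_eq_zero.1 hS _ (fun i hi => ?_) ?_)
  · by_cases hU : i ∈ U
    · simp [ht.2.1 i hi hU, ht'.2.1 i hi hU]
    · simp [ht.2.2 i hi hU, ht'.2.2 i hi hU]
  · rw [map_sub, h, sub_self]

/-- Moving a point of the cube along a direction that points inwards at the coordinates `0` and
`1` stays in the cube for a short time. -/
theorem exists_pos_add_smul_mem_Icc {t g : ι → ℝ} (ht : t ∈ Set.Icc 0 1)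
    (h0 : ∀ i, t i = 0 → 0 ≤ g i) (h1 : ∀ i, t i = 1 → g i ≤ 0) :
    ∃ δ₀ > 0, ∀ δ : ℝ, 0 < δ → δ < δ₀ → t + δ • g ∈ Set.Icc 0 1 := by
  have key : ∀ i, ∀ᶠ δ in nhdsWithin (0 : ℝ) (Set.Ioi 0), 0 ≤ t i + δ * g i ∧ t i + δ * g i ≤ 1 := by
    intro i
    have hl : Filter.Tendsto (fun δ : ℝ => t i + δ * g i) (nhdsWithin (0 : ℝ) (Set.Ioi 0))
        (nhds (t i)) := by
      have : ContinuousAt (fun δ : ℝ => t i + δ * g i) 0 := by fun_prop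
      simpa [ContinuousAt] using this.mono_left nhdsWithin_le_nhds
    have hpos : ∀ᶠ δ in nhdsWithin (0 : ℝ) (Set.Ioi 0), (0 : ℝ) < δ := self_mem_nhdsWithin
    refine Filter.Eventually.and ?_ ?_
    · rcases (show 0 ≤ t i from ht.1 i).eq_or_lt with h | h
      · filter_upwards [hpos] with δ hδ
        have := mul_nonneg hδ.le (h0 i h.symm)
        linarith
      · exact (hl.eventually_const_lt h).mono fun _ h => h.le
    · rcases (show t i ≤ 1 from ht.2 i).eq_or_lt with h | h
      · filter_upwards [hpos] with δ hδ
        have := mul_nonpos_of_nonneg_of_nonpos hδ.le (h1 i h)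
        linarith
      · exact (hl.eventually_lt_const h).mono fun _ h => h.le
  obtain ⟨δ₀, hδ₀, h⟩ := (mem_nhdsGT_iff_exists_Ioo_subset).1 (Filter.eventually_all.2 key)
  exact ⟨δ₀, hδ₀, fun δ hδ hδ' => ⟨fun i => (h ⟨hδ, hδ'⟩ i).1, fun i => (h ⟨hδ, hδ'⟩ i).2⟩⟩

/-- A relation `g` among the free vectors could be added to `t` and subtracted from it for a short
time without leaving the fibre, making `t` a midpoint; extremality forces `g = 0`. -/
theorem linearIndepOn_freeCoords_of_mem_extremePoints {a : ι → N} {y : N} {t : ι → ℝ}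
    (ht : t ∈ (cubeFiber a y).extremePoints ℝ) : LinearIndepOn ℝ a (freeCoords t : Set ι) := by
  rw [linearIndepOn_iff_linearCombination_eq_zero]
  intro g hg h0
  have hne : ∀ i, t i = 0 ∨ t i = 1 → g i = 0 := fun i hi => hg i (by
    rcases hi with hi | hi <;> simp [freeCoords, hi])
  obtain ⟨δ₁, hδ₁, h₁⟩ := exists_pos_add_smul_mem_Icc (g := g) ht.1.1
    (fun i hi => (hne i (.inl hi)).ge) (fun i hi => (hne i (.inr hi)).le)
  obtain ⟨δ₂, hδ₂, h₂⟩ := exists_pos_add_smul_mem_Icc (g := -g) ht.1.1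
    (fun i hi => by simp [hne i (.inl hi)]) (fun i hi => by simp [hne i (.inr hi)])
  obtain ⟨δ, hδ, hδ'⟩ := exists_between (lt_min hδ₁ hδ₂)
  rw [lt_min_iff] at hδ'
  have := ht.2 (x₁ := t + δ • g) ⟨h₁ δ hδ hδ'.1, by simp [h0, ht.1.2]⟩
    (x₂ := t + δ • -g) ⟨h₂ δ hδ hδ'.2, by simp [h0, ht.1.2]⟩
    ⟨1 / 2, 1 / 2, by norm_num, by norm_num, by norm_num, by module⟩
  simpa [hδ.ne'] using this

/-- For the converse: 0 and 1 are extreme in `[0,1]`, so a segment through `t` in the fibre is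
constant off the free coordinates. Its direction is then a relation among independent vectors, hence
zero. -/
theorem mem_extremePoints_cubeFiber_iff {a : ι → N} {y : N} {t : ι → ℝ} :
    t ∈ (cubeFiber a y).extremePoints ℝ ↔
      t ∈ cubeFiber a y ∧ LinearIndepOn ℝ a (freeCoords t : Set ι) := by
  refine ⟨fun h => ⟨h.1, linearIndepOn_freeCoords_of_mem_extremePoints h⟩, fun ⟨ht, hi⟩ => ?_⟩
  refine mem_extremePoints_iff_left.2 ⟨ht, fun x hx z hz ⟨p, q, hp, hq, hpq, hxz⟩ => ?_⟩
  refine sub_eq_zero.1 (linearIndepOn_iff_linearCombination_eq_zero.1 hi _ (fun i hi => ?_) ?_)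
  · have e : p * x i + q * z i = t i := by simpa using congrFun hxz i
    have hx0 : 0 ≤ x i := hx.1.1 i
    have hx1 : x i ≤ 1 := hx.1.2 i
    have hz0 : 0 ≤ z i := hz.1.1 i
    have hz1 : z i ≤ 1 := hz.1.2 i
    have hF := mem_openFace_coords ht.1
    have hq' : q = 1 - p := by linarith
    subst hq'
    rw [Pi.sub_apply, sub_eq_zero]
    by_cases hU : i ∈ topCoords t
    · rw [hF.2.1 i hi hU] at e ⊢
      nlinarith [mul_nonneg hq.le (sub_nonneg.2 hz1)]
    · rw [hF.2.2 i hi hU] at e ⊢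
      nlinarith [mul_nonneg hq.le hz0]
  · rw [map_sub, hx.2, ht.2, sub_self]

/-- The map is injective on an open face whose free vectors are independent, so a vertex is
determined by its face. This bounds the vertices of every fibre, generic or not. -/
theorem injOn_coords_extremePoints (a : ι → N) (y : N) :
    Set.InjOn (fun t : ι → ℝ => (⟨freeCoords t, topCoords t⟩ : (_ : Finset ι) × Finset ι))
      ((cubeFiber a y).extremePoints ℝ) := by
  intro t ht t' ht' h
  simp only [Sigma.mk.injEq, heq_eq_eq] at h
  have h1 := mem_openFace_coords ht'.1.1
  rw [← h.1, ← h.2] at h1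
  exact eq_of_mem_openFace (linearIndepOn_freeCoords_of_mem_extremePoints ht)
    (mem_openFace_coords ht.1.1) h1 (ht.1.2.trans ht'.1.2.symm)

theorem finite_extremePoints_cubeFiber (a : ι → N) (y : N) :
    ((cubeFiber a y).extremePoints ℝ).Finite :=
  Set.Finite.of_finite_image (Set.toFinite _) (injOn_coords_extremePoints a y)

theorem IsCubeGeneric.span_freeCoords_eq_top {a : ι → N} {y : N} (hy : IsCubeGeneric a y)
    {t : ι → ℝ} (ht : t ∈ cubeFiber a y) : Submodule.span ℝ (a '' freeCoords t) = ⊤ := by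
  by_contra h
  refine hy _ (topCoords t) h ?_
  have hF := mem_openFace_coords ht.1
  have e : y = ∑ i ∈ freeCoords t, t i • a i + ∑ i ∈ topCoords t, a i := by
    classical
    rw [← ht.2, Fintype.linearCombination_apply,
      ← Finset.sum_subset (Finset.subset_univ (freeCoords t ∪ topCoords t)) fun i _ hi => by
        rw [Finset.mem_union, not_or] at hi
        simp [hF.2.2 i hi.1 hi.2],
      Finset.sum_union (disjoint_freeCoords_topCoords t)]
    congr 1
    refine Finset.sum_congr rfl fun i hi => ?_
    rw [hF.2.1 i (Finset.disjoint_right.1 (disjoint_freeCoords_topCoords t) hi) hi, one_smul]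
  rw [e, add_sub_cancel_right]
  exact Submodule.sum_mem _ fun i hi =>
    Submodule.smul_mem _ _ (Submodule.subset_span ⟨i, hi, rfl⟩)

theorem IsCubeGeneric.isBasisIndex_freeCoords {a : ι → N} {y : N} (hy : IsCubeGeneric a y)
    {t : ι → ℝ} (ht : t ∈ (cubeFiber a y).extremePoints ℝ) : IsBasisIndex a (freeCoords t) :=
  ⟨linearIndepOn_freeCoords_of_mem_extremePoints ht, hy.span_freeCoords_eq_top ht.1⟩

open scoped Classical in
theorem IsCubeGeneric.ncard_extremePoints {a : ι → N} {y : N} (hy : IsCubeGeneric a y) :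
    (((cubeFiber a y).extremePoints ℝ).ncard : ℝ) =
      ∑ S ∈ basisIndices a, ∑ U ∈ Sᶜ.powerset, (openCell a S U).indicator 1 y := by
  rw [← (injOn_coords_extremePoints a y).ncard_image]
  have himg : (fun t : ι → ℝ => (⟨freeCoords t, topCoords t⟩ : (_ : Finset ι) × Finset ι)) ''
      ((cubeFiber a y).extremePoints ℝ) =
      (((basisIndices a).sigma fun S => Sᶜ.powerset).filter fun p => y ∈ openCell a p.1 p.2 :
        Finset ((_ : Finset ι) × Finset ι)) := by
    ext ⟨S, U⟩
    simp only [Set.mem_image, Finset.coe_filter, Finset.mem_sigma, Set.mem_ofPred_eq,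
      Finset.mem_powerset, basisIndices, Finset.mem_filter, Finset.mem_univ, true_and]
    constructor
    · rintro ⟨t, ht, h⟩
      simp only [Sigma.mk.injEq, heq_eq_eq] at h
      obtain ⟨rfl, rfl⟩ := h
      exact ⟨⟨hy.isBasisIndex_freeCoords ht,
        Finset.subset_compl_iff_disjoint_left.2 (disjoint_freeCoords_topCoords t)⟩,
        t, mem_openFace_coords ht.1.1, ht.1.2⟩
    · rintro ⟨⟨hS, hU⟩, t, ht, hty⟩
      have e := freeCoords_eq_of_mem_openFace ht
      refine ⟨t, mem_extremePoints_cubeFiber_iff.2 ⟨⟨openFace_subset_Icc _ _ ht, hty⟩, ?_⟩, ?_⟩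
      · rw [e]; exact hS.1
      · rw [e, topCoords_eq_of_mem_openFace (Finset.subset_compl_iff_disjoint_left.1 hU) ht]
  rw [himg, Set.ncard_coe_finset, Finset.card_filter, Finset.sum_sigma]
  push_cast
  simp [Set.indicator_apply]

/-! ### Tiling the zonotope by one cell per basis. -/

/-- For a basis `S` among the `a i` and `j ∉ S` there is a relation among the `a i` that involves,
besides `a j`, only the vectors of the basis. -/
theorem IsBasisIndex.exists_relation {a : ι → N} {S : Finset ι} (hS : IsBasisIndex a S) {j : ι}
    (hj : j ∉ S) : ∃ d : ι → ℝ, Fintype.linearCombination ℝ a d = 0 ∧ d j = 1 ∧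
      ∀ i ∉ S, i ≠ j → d i = 0 := by
  classical
  have hmem : a j ∈ Submodule.span ℝ (a '' S) := by rw [hS.2]; trivial
  obtain ⟨g, hg⟩ := (Submodule.mem_span_image_finset_iff_exists_fun' ℝ).1 hmem
  refine ⟨fun i => if i ∈ S then - g i else if i = j then 1 else 0, ?_, by simp [hj],
    fun i hi hij => by simp [hi, hij]⟩
  rw [Fintype.linearCombination_apply, ← Finset.sum_add_sum_compl S,
    Finset.sum_eq_single_of_mem j (Finset.mem_compl.2 hj) fun i hi hij => by
      simp [Finset.mem_compl.1 hi, hij], ← hg,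
    Finset.sum_congr rfl fun i hi => by rw [if_pos hi], Finset.sum_congr rfl fun i hi => neg_smul _ _]
  simp [hj]

open scoped Classical in
/-- A vector in the kernel is the combination of the relations of `IsBasisIndex.exists_relation`
weighted by its coordinates outside the basis. -/
theorem IsBasisIndex.eq_sum_smul_relation {a : ι → N} {S : Finset ι} (hS : IsBasisIndex a S)
    {d : ι → ι → ℝ} (hd : ∀ j ∉ S, Fintype.linearCombination ℝ a (d j) = 0 ∧ d j j = 1 ∧
      ∀ i ∉ S, i ≠ j → d j i = 0) {g : ι → ℝ} (hg : Fintype.linearCombination ℝ a g = 0) :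
    g = ∑ j with j ∉ S, g j • d j := by
  refine sub_eq_zero.1 (linearIndepOn_iff_linearCombination_eq_zero.1 hS.1 _ (fun i hi => ?_) ?_)
  · rw [Pi.sub_apply, Finset.sum_apply, Finset.sum_eq_single_of_mem i (by simpa using hi)
      fun j hj hji => by simp [(hd j (by simpa using hj)).2.2 i hi hji.symm]]
    simp [(hd i hi).2.1]
  · rw [map_sub, hg, map_sum, Finset.sum_eq_zero, sub_zero]
    intro j hj
    rw [map_smul, (hd j (by simpa using hj)).1, smul_zero]

theorem isCompact_cubeFiber [TopologicalSpace N] [IsTopologicalAddGroup N] [ContinuousSMul ℝ N]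
    [T1Space N] (a : ι → N) (y : N) : IsCompact (cubeFiber a y) := by
  have hc : Continuous (Fintype.linearCombination ℝ a) :=
    LinearMap.continuous_on_pi _
  exact isCompact_Icc.inter_right (isClosed_singleton.preimage hc)

open scoped Classical in
/-- Choosing for every basis the right face, the images of these faces tile the zonotope, up to
non-generic points. The face is the one on which a fixed generic functional is maximal. -/
theorem exists_tiling [TopologicalSpace N] [IsTopologicalAddGroup N] [ContinuousSMul ℝ N]
    [T1Space N] (a : ι → N) : ∃ U : Finset ι → Finset ι, ∀ y, IsCubeGeneric a y →
      (Fintype.linearCombination ℝ a '' Set.Icc 0 1).indicator (1 : N → ℝ) y =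
        ∑ S ∈ basisIndices a, (openCell a S (U S)).indicator 1 y := by
  have hex : ∀ S : Finset ι, ∀ j : ι, ∃ d : ι → ℝ, IsBasisIndex a S → j ∉ S →
      Fintype.linearCombination ℝ a d = 0 ∧ d j = 1 ∧ ∀ i ∉ S, i ≠ j → d i = 0 := by
    intro S j
    by_cases h : IsBasisIndex a S ∧ j ∉ S
    · obtain ⟨d, hd⟩ := h.1.exists_relation h.2
      exact ⟨d, fun _ _ => hd⟩
    · exact ⟨0, fun h1 h2 => absurd ⟨h1, h2⟩ h⟩
  choose d hd using hex
  -- Each relation `d S j` is nonzero, its `j`-th coordinate being 1, and there are finitely many of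
  -- them; so some functional vanishes on none.
  obtain ⟨f, hf⟩ := Module.exists_dual_forall_apply_ne_zero (K := ℝ)
    (fun p : {p : Finset ι × ι // IsBasisIndex a p.1 ∧ p.2 ∉ p.1} => d p.1.1 p.1.2)
    (fun p h => by simpa [h] using (hd _ _ p.2.1 p.2.2).2.1)
  replace hf : ∀ S j, IsBasisIndex a S → j ∉ S → f (d S j) ≠ 0 :=
    fun S j h1 h2 => hf ⟨(S, j), h1, h2⟩
  -- Coordinate `j` is put at 1 exactly when `f` increases along `d S j`, so that moving into the
  -- cube lowers `f`.
  let U : Finset ι → Finset ι := fun S => Finset.univ.filter fun j => 0 < f (d S j)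
  -- A point of the chosen face is the unique maximizer of `f` on its fibre: `f x - f t` is a sum of
  -- nonpositive terms whose factors `f (d S j)` are nonzero.
  have hmax : ∀ {S t x}, IsBasisIndex a S → t ∈ openFace S (U S) → x ∈ Set.Icc (0 : ι → ℝ) 1 →
      Fintype.linearCombination ℝ a x = Fintype.linearCombination ℝ a t →
      f x ≤ f t ∧ (f x = f t → x = t) := by
    intro S t x hS ht hx hxt
    have hker : Fintype.linearCombination ℝ a (x - t) = 0 := by rw [map_sub, hxt, sub_self]
    have hsum := hS.eq_sum_smul_relation (hd S · hS) hker
    have hterm : ∀ j ∉ S, (x - t) j * f (d S j) ≤ 0 := by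
      intro j hj
      by_cases hU : j ∈ U S
      · have h1 : x j ≤ 1 := hx.2 j
        rw [Pi.sub_apply, ht.2.1 j hj hU]
        exact mul_nonpos_of_nonpos_of_nonneg (by linarith) (Finset.mem_filter.1 hU).2.le
      · have h0 : 0 ≤ x j := hx.1 j
        rw [Pi.sub_apply, ht.2.2 j hj hU, sub_zero]
        exact mul_nonpos_of_nonneg_of_nonpos h0 (by simpa [U] using hU)
    have hfs : f x - f t = ∑ j with j ∉ S, (x - t) j * f (d S j) := by
      rw [← map_sub]
      conv_lhs => rw [hsum]
      simp only [map_sum, map_smul, smul_eq_mul]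
    refine ⟨?_, fun h => sub_eq_zero.1 ?_⟩
    · rw [← sub_nonpos, hfs]
      exact Finset.sum_nonpos fun j hj => hterm j (by simpa using hj)
    · rw [h, sub_self, eq_comm, Finset.sum_eq_zero_iff_of_nonpos
        fun j hj => hterm j (by simpa using hj)] at hfs
      rw [hsum]
      refine Finset.sum_eq_zero fun j hj => ?_
      have hj' : j ∉ S := by simpa using hj
      rw [(mul_eq_zero.1 (hfs j hj)).resolve_right (hf S j hS hj'), zero_smul]
  refine ⟨U, fun y hy => ?_⟩
  have hsub : ∀ {S}, y ∈ openCell a S (U S) →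
      y ∈ Fintype.linearCombination ℝ a '' Set.Icc 0 1 :=
    fun {S} h => Set.image_mono (openFace_subset_Icc _ _) h
  by_cases hyZ : y ∈ Fintype.linearCombination ℝ a '' Set.Icc 0 1
  · obtain ⟨S, hS, hyS⟩ : ∃ S, IsBasisIndex a S ∧ y ∈ openCell a S (U S) := by
      obtain ⟨m, hm, hm'⟩ := (isCompact_cubeFiber a y).exists_isMaxOn hyZ
        (LinearMap.continuous_of_finiteDimensional f).continuousOn
      -- The maximizers of `f` form an exposed face of the fibre; an extreme point of that face is a
      -- vertex of the fibre that maximizes `f`.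
      let l : StrongDual ℝ (ι → ℝ) := LinearMap.toContinuousLinearMap f
      have hexp : IsExposed ℝ (cubeFiber a y) (l.toExposed (cubeFiber a y)) :=
        ContinuousLinearMap.toExposed.isExposed
      obtain ⟨t, ht⟩ := (hexp.isCompact (isCompact_cubeFiber a y)).extremePoints_nonempty
        ⟨m, hm, hm'⟩
      have htmax : ∀ x ∈ cubeFiber a y, f x ≤ f t := ht.1.2
      replace ht := hexp.isExtreme.extremePoints_subset_extremePoints ht
      have hS := hy.isBasisIndex_freeCoords ht
      refine ⟨_, hS, t, ?_, ht.1.2⟩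
      have hF := mem_openFace_coords ht.1.1
      -- Off the free coordinates `s • d _ j` changes only coordinate `j`, and there it points
      -- inwards; a short move stays in the fibre and cannot raise `f`.
      have hmove : ∀ j, (j ∉ freeCoords t) → ∀ s : ℝ, (t j = 0 → 0 ≤ s) → (t j = 1 → s ≤ 0) →
          s * f (d (freeCoords t) j) ≤ 0 := by
        intro j hj s h0 h1
        have hdj := hd _ j hS hj
        have aux : ∀ i ∉ freeCoords t, i ≠ j → (s • d (freeCoords t) j) i = 0 :=
          fun i hi hij => by simp [hdj.2.2 i hi hij]
        have hout : ∀ i, t i = 0 ∨ t i = 1 → i ∉ freeCoords t := fun i hi => by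
          rcases hi with hi | hi <;> simp [freeCoords, hi]
        obtain ⟨δ₀, hδ₀, h⟩ := exists_pos_add_smul_mem_Icc (g := s • d (freeCoords t) j) ht.1.1
          (fun i hi => by
            rcases eq_or_ne i j with rfl | hij
            · simpa [hdj.2.1] using h0 hi
            · exact (aux i (hout i (.inl hi)) hij).ge)
          (fun i hi => by
            rcases eq_or_ne i j with rfl | hij
            · simpa [hdj.2.1] using h1 hi
            · exact (aux i (hout i (.inr hi)) hij).le)
        have := htmax _ ⟨h (δ₀ / 2) (by linarith) (by linarith), by
          simp [hdj.1, ht.1.2]⟩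
        simp only [map_add, map_smul, smul_eq_mul, add_le_iff_nonpos_right] at this
        exact nonpos_of_mul_nonpos_right this (by linarith)
      refine ⟨hF.1, fun j hj hU => ?_, fun j hj hU => ?_⟩
      · by_contra h
        have h0 := hmove j hj 1 (fun _ => zero_le_one) fun h' => absurd h' h
        have : 0 < f (d (freeCoords t) j) := (Finset.mem_filter.1 hU).2
        linarith
      · by_contra h
        have h0 := hmove j hj (-1) (fun h' => absurd h' h) fun _ => by norm_num
        have h1 : f (d (freeCoords t) j) ≤ 0 := by simpa [U] using hU
        exact hf _ j hS hj (by linarith)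
    rw [Set.indicator_of_mem hyZ, Finset.sum_eq_single_of_mem S
      (show S ∈ basisIndices a from Finset.mem_filter.2 ⟨Finset.mem_univ _, hS⟩), Set.indicator_of_mem hyS]
    -- Two chosen cells containing `y` would give two maximizers on one fibre; these coincide, and
    -- so do their free coordinates.
    intro S' hS' hne
    refine Set.indicator_of_notMem (fun hyS' => hne ?_) _
    obtain ⟨t, ht, rfl⟩ := hyS
    obtain ⟨t', ht', hy'⟩ := hyS'
    have hS'' : IsBasisIndex a S' := (Finset.mem_filter.1 hS').2
    have h1 := hmax hS ht (openFace_subset_Icc _ _ ht') hy'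
    have h2 := hmax hS'' ht' (openFace_subset_Icc _ _ ht) hy'.symm
    have := h1.2 (le_antisymm h1.1 h2.1)
    rw [← freeCoords_eq_of_mem_openFace ht, ← freeCoords_eq_of_mem_openFace ht', this]
  · rw [Set.indicator_of_notMem hyZ, eq_comm]
    exact Finset.sum_eq_zero fun S _ => Set.indicator_of_notMem (fun h => hyZ (hsub h)) _

end Combinatorics

/-! ### Measures of the cells and the expected vertex count of a fibre. -/

section Measure

/-- The cells of one `S` are translates of each other. The shift runs over `U \ S` because `openFace
S U` ignores `U` inside `S`. -/
theorem openCell_eq_preimage {ι N : Type*} [Fintype ι] [DecidableEq ι] [AddCommGroup N]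
    [Module ℝ N] (a : ι → N) (S U : Finset ι) :
    openCell a S U = (fun y => -(∑ i ∈ U \ S, a i) + y) ⁻¹' openCell a S ∅ := by
  have hu : Fintype.linearCombination ℝ a (fun i => if i ∈ U \ S then 1 else 0) =
      ∑ i ∈ U \ S, a i := by
    simp only [Fintype.linearCombination_apply, ite_smul, one_smul, zero_smul,
      Finset.sum_ite_mem, Finset.univ_inter]
  ext y
  simp only [openCell, Set.mem_preimage, Set.mem_image]
  constructor
  · rintro ⟨t, ht, rfl⟩
    refine ⟨t - fun i => if i ∈ U \ S then 1 else 0, ⟨fun i hi => ?_, by simp, fun i hi _ => ?_⟩, ?_⟩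
    · simpa [hi] using ht.1 i hi
    · by_cases hU : i ∈ U
      · simp [hi, hU, ht.2.1 i hi hU]
      · simp [hU, ht.2.2 i hi hU]
    · rw [map_sub, hu]; abel
  · rintro ⟨t, ht, hy⟩
    refine ⟨t + fun i => if i ∈ U \ S then 1 else 0, ⟨fun i hi => ?_, fun i hi hU => ?_,
      fun i hi hU => ?_⟩, ?_⟩
    · simpa [hi] using ht.1 i hi
    · simp [hi, hU, ht.2.2 i hi]
    · simp [hU, ht.2.2 i hi]
    · rw [map_add, hu, hy]; abel

theorem openCell_subset {ι N : Type*} [Fintype ι] [AddCommGroup N] [Module ℝ N] (a : ι → N)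
    (S U : Finset ι) : openCell a S U ⊆ Fintype.linearCombination ℝ a '' Set.Icc 0 1 :=
  Set.image_mono (openFace_subset_Icc S U)

theorem IsBasisIndex.card_compl {ι N : Type*} [Fintype ι] [DecidableEq ι] [AddCommGroup N]
    [Module ℝ N] {a : ι → N} {S : Finset ι} (hS : IsBasisIndex a S) :
    Sᶜ.card = Fintype.card ι - Module.finrank ℝ N := by
  have h := finrank_span_eq_card hS.1
  rw [← Set.image_eq_range, hS.2, finrank_top] at h
  rw [Finset.card_compl, h]
  simp

theorem isCompact_image_linearCombination_Icc {ι N : Type*} [Fintype ι] [NormedAddCommGroup N]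
    [NormedSpace ℝ N] (a : ι → N) :
    IsCompact (Fintype.linearCombination ℝ a '' Set.Icc 0 1) :=
  isCompact_Icc.image (LinearMap.continuous_on_pi _)

theorem measure_openCell {ι N : Type*} [Fintype ι] [NormedAddCommGroup N] [NormedSpace ℝ N]
    [MeasurableSpace N] [BorelSpace N] (μ : Measure N) [μ.IsAddHaarMeasure] (a : ι → N) (S U : Finset ι) :
    μ (openCell a S U) = μ (openCell a S ∅) := by
  classical
  rw [openCell_eq_preimage, measure_preimage_add]

variable {ι N : Type*} [Fintype ι] [NormedAddCommGroup N] [NormedSpace ℝ N]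
  [FiniteDimensional ℝ N]

theorem IsBasisIndex.isOpen_openCell {a : ι → N} {S : Finset ι} (hS : IsBasisIndex a S)
    (U : Finset ι) : IsOpen (openCell a S U) := by
  classical
  rw [openCell_eq_preimage]
  refine IsOpen.preimage (by fun_prop) ?_
  have himg : openCell a S ∅ = Fintype.linearCombination ℝ (fun i : S => a i) ''
      (Set.univ.pi fun _ => Set.Ioo (0 : ℝ) 1) := by
    ext y
    constructor
    · rintro ⟨t, ht, rfl⟩
      refine ⟨fun i => t i, fun i _ => ht.1 i i.2, ?_⟩
      rw [Fintype.linearCombination_apply, Fintype.linearCombination_apply,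
        ← Finset.sum_subset S.subset_univ fun i _ hi => by simp [ht.2.2 i hi]]
      exact Finset.sum_coe_sort S fun i => t i • a i
    · rintro ⟨s, hs, rfl⟩
      refine ⟨fun i => if h : i ∈ S then s ⟨i, h⟩ else 0, ⟨fun i hi => ?_, by simp,
        fun i hi _ => by simp [hi]⟩, ?_⟩
      · simpa [hi] using hs ⟨i, hi⟩ trivial
      · rw [Fintype.linearCombination_apply, Fintype.linearCombination_apply,
          ← Finset.sum_subset S.subset_univ fun i _ hi => by simp [hi], ← Finset.sum_coe_sort]
        simp
  rw [himg]
  refine LinearMap.isOpenMap_of_finiteDimensional _ ?_ _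
    (isOpen_set_pi Set.finite_univ fun _ _ => isOpen_Ioo)
  rw [← LinearMap.range_eq_top, Fintype.range_linearCombination, ← hS.2, Set.image_eq_range]
  rfl

theorem measure_image_linearCombination_Icc_pos [MeasurableSpace N] (μ : Measure N)
    [μ.IsOpenPosMeasure] {a : ι → N}
    (ha : Submodule.span ℝ (Set.range a) = ⊤) :
    0 < μ (Fintype.linearCombination ℝ a '' Set.Icc 0 1) := by
  have hopen : IsOpen (Fintype.linearCombination ℝ a '' (Set.univ.pi fun _ => Set.Ioo 0 1)) := by
    refine LinearMap.isOpenMap_of_finiteDimensional _ ?_ _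
      (isOpen_set_pi Set.finite_univ fun _ _ => isOpen_Ioo)
    rw [← LinearMap.range_eq_top, Fintype.range_linearCombination, ha]
  refine (hopen.measure_pos μ ⟨_, fun _ => 1 / 2, fun _ _ => by norm_num, rfl⟩).trans_le
    (measure_mono (Set.image_mono fun t ht => ⟨fun i => (ht i trivial).1.le,
      fun i => (ht i trivial).2.le⟩))

variable [MeasurableSpace N] [BorelSpace N] (μ : Measure N) [μ.IsAddHaarMeasure]

/-- The non-generic points lie in finitely many translates of proper subspaces, each of measure
zero. -/
theorem ae_isCubeGeneric (a : ι → N) : ∀ᵐ y ∂μ, IsCubeGeneric a y := by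
  refine ae_all_iff.2 fun T => ae_all_iff.2 fun U => ?_
  by_cases h : Submodule.span ℝ (a '' T) = ⊤
  · exact Filter.Eventually.of_forall fun _ h' => absurd h h'
  · have h0 : μ ((fun y => -(∑ i ∈ U, a i) + y) ⁻¹' (Submodule.span ℝ (a '' T) : Set N)) = 0 := by
      rw [measure_preimage_add, Measure.addHaar_submodule μ _ h]
    filter_upwards [measure_eq_zero_iff_ae_notMem.1 h0] with y hy _ hy'
    exact hy (by simpa [sub_eq_neg_add] using hy')

theorem integral_ncard_extremePoints_cubeFiber {a : ι → N}
    (ha : Submodule.span ℝ (Set.range a) = ⊤) :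
    Integrable (fun y => (((cubeFiber a y).extremePoints ℝ).ncard : ℝ))
        (ProbabilityTheory.cond μ (Fintype.linearCombination ℝ a '' Set.Icc 0 1)) ∧
      ∫ y, (((cubeFiber a y).extremePoints ℝ).ncard : ℝ)
        ∂(ProbabilityTheory.cond μ (Fintype.linearCombination ℝ a '' Set.Icc 0 1)) =
      2 ^ (Fintype.card ι - Module.finrank ℝ N) := by
  classical
  have hZc := isCompact_image_linearCombination_Icc a
  have hpos := measure_image_linearCombination_Icc_pos μ ha
  set Z := Fintype.linearCombination ℝ a '' Set.Icc 0 1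
  set P := ProbabilityTheory.cond μ Z with hP
  have hprob : IsProbabilityMeasure P :=
    ProbabilityTheory.cond_isProbabilityMeasure_of_finite hpos.ne' hZc.measure_lt_top.ne
  have hgen : ∀ᵐ y ∂P, IsCubeGeneric a y :=
    ProbabilityTheory.cond_absolutelyContinuous.ae_le (ae_isCubeGeneric μ a)
  have hcell : ∀ S ∈ basisIndices a, ∀ U, MeasurableSet (openCell a S U) := fun S hS U =>
    ((Finset.mem_filter.1 hS).2.isOpen_openCell U).measurableSet
  have hreal : ∀ S U, P.real (openCell a S U) = P.real (openCell a S ∅) := fun S U => by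
    rw [measureReal_def, measureReal_def, hP, ProbabilityTheory.cond_apply hZc.measurableSet,
      ProbabilityTheory.cond_apply hZc.measurableSet,
      Set.inter_eq_self_of_subset_right (openCell_subset a S U),
      Set.inter_eq_self_of_subset_right (openCell_subset a S ∅), measure_openCell]
  have hint : ∀ S ∈ basisIndices a, ∀ U,
      Integrable ((openCell a S U).indicator (1 : N → ℝ)) P := fun S hS U =>
    (integrable_const (1 : ℝ)).indicator (hcell S hS U)
  -- Integrate the tiling identity; translation invariance replaces each chosen pattern `U S` by
  -- `∅`.
  have hsum : ∑ S ∈ basisIndices a, P.real (openCell a S ∅) = 1 := by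
    obtain ⟨U, hU⟩ := exists_tiling a
    have h := integral_congr_ae (hgen.mono fun y hy => hU y hy)
    rw [integral_indicator_one hZc.measurableSet,
      integral_finsetSum _ fun S hS => hint S hS _] at h
    have hPZ : P.real Z = 1 := by
      rw [measureReal_def, hP, ProbabilityTheory.cond_apply_self hpos.ne' hZc.measure_lt_top.ne,
        ENNReal.toReal_one]
    rw [← hPZ, h]
    refine Finset.sum_congr rfl fun S hS => ?_
    rw [integral_indicator_one (hcell S hS _), hreal S (U S)]
  have hae : (fun y => (((cubeFiber a y).extremePoints ℝ).ncard : ℝ)) =ᵐ[P] fun y =>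
      ∑ S ∈ basisIndices a, ∑ U ∈ Sᶜ.powerset, (openCell a S U).indicator 1 y :=
    hgen.mono fun y hy => by convert! hy.ncard_extremePoints
  refine ⟨(integrable_finsetSum _ fun S hS => integrable_finsetSum _ fun U _ =>
    hint S hS U).congr hae.symm, ?_⟩
  -- With the target written as `2 ^ _` times the sum in `hsum`, the two sides are compared basis by
  -- basis.
  rw [integral_congr_ae hae, integral_finsetSum _ fun S hS =>
    integrable_finsetSum _ fun U _ => hint S hS U, ← mul_one (2 ^ _ : ℝ), ← hsum, Finset.mul_sum]
  refine Finset.sum_congr rfl fun S hS => ?_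
  rw [integral_finsetSum _ fun U _ => hint S hS U, Finset.sum_congr rfl fun U _ => by
    rw [integral_indicator_one (hcell S hS U), hreal], Finset.sum_const, Finset.card_powerset,
    (Finset.mem_filter.1 hS).2.card_compl]
  simp

end Measure

/-! ### Transfer from fibres of the unit cube to slices. -/

theorem cond_preimage_neg_add {G : Type*} [AddCommGroup G] [MeasurableSpace G] [MeasurableAdd G]
    (μ : Measure G) [μ.IsAddLeftInvariant] (g : G) (s : Set G) :
    ProbabilityTheory.cond μ ((fun y => -g + y) ⁻¹' s) =
      (ProbabilityTheory.cond μ s).map (MeasurableEquiv.addLeft g) := by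
  have hpre : MeasurableEquiv.addLeft g ⁻¹' ((fun y => -g + y) ⁻¹' s) = s := by
    ext y; simp
  have h := (MeasurableEquiv.addLeft g).restrict_map μ ((fun y => -g + y) ⁻¹' s)
  rw [hpre] at h
  have hmap : μ.map (MeasurableEquiv.addLeft g) = μ := map_add_left_eq_self μ g
  rw [hmap] at h
  rw [ProbabilityTheory.cond, ProbabilityTheory.cond, measure_preimage_add, Measure.map_smul, h]

theorem AffineMap.image_extremePoints_of_injective {E F : Type*} [AddCommGroup E] [Module ℝ E]
    [AddCommGroup F] [Module ℝ F] (f : E →ᵃ[ℝ] F) (hf : Function.Injective f) (s : Set E) :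
    f '' s.extremePoints ℝ = (f '' s).extremePoints ℝ := by
  have hseg : ∀ x y z, f z ∈ openSegment ℝ (f x) (f y) ↔ z ∈ openSegment ℝ x y := fun x y z => by
    rw [← image_openSegment, hf.mem_set_image]
  ext y
  constructor
  · rintro ⟨t, ht, rfl⟩
    refine ⟨⟨t, ht.1, rfl⟩, ?_⟩
    rintro _ ⟨x, hx, rfl⟩ _ ⟨z, hz, rfl⟩ h
    rw [ht.2 hx hz ((hseg x z t).1 h)]
  · rintro ⟨⟨t, ht, rfl⟩, h⟩
    exact ⟨t, ⟨ht, fun x hx z hz hxz =>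
      hf (h ⟨x, hx, rfl⟩ ⟨z, hz, rfl⟩ ((hseg x z t).2 hxz))⟩, rfl⟩

variable {n : ℕ}

theorem parallelotope_eq_image (a : EuclideanSpace ℝ (Fin n))
    (w : Fin n → EuclideanSpace ℝ (Fin n)) :
    parallelotope a w = (fun t => a + Fintype.linearCombination ℝ w t) '' Set.Icc 0 1 := by
  rw [parallelotope, parallelepiped, Set.image_image]
  rfl

/-- A point lies in `τ + W` iff its projection to `Wᗮ` is `τ`, which is a linear condition on the
cube parameter `t`. -/
theorem slice_parallelotope (W : Submodule ℝ (EuclideanSpace ℝ (Fin n)))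
    (a : EuclideanSpace ℝ (Fin n)) (w : Fin n → EuclideanSpace ℝ (Fin n)) (τ : Wᗮ) :
    slice (parallelotope a w) W τ = (fun t => a + Fintype.linearCombination ℝ w t) ''
      cubeFiber (fun i => Wᗮ.orthogonalProjectionOnto (w i))
        (-Wᗮ.orthogonalProjectionOnto a + τ) := by
  have key : ∀ t, a + Fintype.linearCombination ℝ w t ∈ AffineSubspace.mk' (τ : EuclideanSpace ℝ (Fin n)) W ↔
      Fintype.linearCombination ℝ (fun i => Wᗮ.orthogonalProjectionOnto (w i)) t =
        -Wᗮ.orthogonalProjectionOnto a + τ := by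
    intro t
    have h : ∀ x, x ∈ W ↔ Wᗮ.orthogonalProjectionOnto x = 0 := fun x => by
      rw [Submodule.orthogonalProjectionOnto_eq_zero_iff, Submodule.orthogonal_orthogonal]
    rw [AffineSubspace.mem_mk', vsub_eq_sub, h, map_sub, map_add,
      Submodule.orthogonalProjectionOnto_mem_subspace_eq_self, sub_eq_zero,
      Fintype.linearCombination_apply, Fintype.linearCombination_apply, map_sum, eq_neg_add_iff_add_eq]
    simp only [map_smul]
  rw [slice, parallelotope_eq_image]
  ext x
  constructor
  · rintro ⟨⟨t, ht, rfl⟩, hx⟩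
    exact ⟨t, ⟨ht, (key t).1 hx⟩, rfl⟩
  · rintro ⟨t, ⟨ht, ht'⟩, rfl⟩
    exact ⟨⟨t, ht, rfl⟩, (key t).2 ht'⟩

theorem injective_add_linearCombination (a : EuclideanSpace ℝ (Fin n))
    {w : Fin n → EuclideanSpace ℝ (Fin n)} (hw : LinearIndependent ℝ w) :
    Function.Injective fun t => a + Fintype.linearCombination ℝ w t :=
  (add_right_injective a).comp (hw.fintypeLinearCombination_injective)

theorem sliceVertices_parallelotope (W : Submodule ℝ (EuclideanSpace ℝ (Fin n)))
    (a : EuclideanSpace ℝ (Fin n)) {w : Fin n → EuclideanSpace ℝ (Fin n)}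
    (hw : LinearIndependent ℝ w) (τ : Wᗮ) :
    sliceVertices (parallelotope a w) W τ = (fun t => a + Fintype.linearCombination ℝ w t) ''
      (cubeFiber (fun i => Wᗮ.orthogonalProjectionOnto (w i))
        (-Wᗮ.orthogonalProjectionOnto a + τ)).extremePoints ℝ := by
  let f : (Fin n → ℝ) →ᵃ[ℝ] EuclideanSpace ℝ (Fin n) :=
    AffineMap.const ℝ _ a + (Fintype.linearCombination ℝ w).toAffineMap
  rw [sliceVertices, slice_parallelotope]
  exact (f.image_extremePoints_of_injective (injective_add_linearCombination a hw) _).symm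

theorem translationLaw_parallelotope (W : Submodule ℝ (EuclideanSpace ℝ (Fin n)))
    (a : EuclideanSpace ℝ (Fin n)) (w : Fin n → EuclideanSpace ℝ (Fin n)) :
    translationLaw (parallelotope a w) W =
      (ProbabilityTheory.cond volume (Fintype.linearCombination ℝ
        (fun i => Wᗮ.orthogonalProjectionOnto (w i)) '' Set.Icc 0 1)).map
        (MeasurableEquiv.addLeft (Wᗮ.orthogonalProjectionOnto a)) := by
  rw [← cond_preimage_neg_add, translationLaw, parallelotope_eq_image, ← Set.image_add_left,
    Set.image_image, Set.image_image]
  simp only [map_add, Fintype.linearCombination_apply, map_sum, map_smul]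

theorem sliceVertices_parallelotope_finite_integrable_integral
    (W : Submodule ℝ (EuclideanSpace ℝ (Fin n)))
    (a : EuclideanSpace ℝ (Fin n)) {w : Fin n → EuclideanSpace ℝ (Fin n)}
    (hw : LinearIndependent ℝ w) :
    (∀ τ : Wᗮ, (sliceVertices (parallelotope a w) W τ).Finite) ∧
      Integrable (fun τ : Wᗮ => ((sliceVertices (parallelotope a w) W τ).ncard : ℝ))
        (translationLaw (parallelotope a w) W) ∧
      ∫ τ : Wᗮ, ((sliceVertices (parallelotope a w) W τ).ncard : ℝ)
        ∂(translationLaw (parallelotope a w) W) = 2 ^ Module.finrank ℝ W := by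
  have hspan : Submodule.span ℝ (Set.range fun i => Wᗮ.orthogonalProjectionOnto (w i)) = ⊤ := by
    -- The edge vectors span the whole space and the projection is onto, so their projections span
    -- `Wᗮ`.
    have h := hw.span_eq_top_of_card_eq_finrank' (by simp)
    have hr : (Set.range fun i => Wᗮ.orthogonalProjectionOnto (w i)) =
        Wᗮ.orthogonalProjectionOnto.toLinearMap '' Set.range w := (Set.range_comp _ w)
    rw [hr, Submodule.span_image, h, Submodule.map_top, LinearMap.range_eq_top]
    exact fun y => ⟨y, Submodule.orthogonalProjectionOnto_mem_subspace_eq_self y⟩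
  have hcard : Fintype.card (Fin n) - Module.finrank ℝ Wᗮ = Module.finrank ℝ W := by
    have := W.finrank_add_finrank_orthogonal
    rw [finrank_euclideanSpace] at this
    omega
  obtain ⟨hi, he⟩ := integral_ncard_extremePoints_cubeFiber volume hspan
  simp only [sliceVertices_parallelotope W a hw,
    Set.ncard_image_of_injective _ (injective_add_linearCombination a hw),
    translationLaw_parallelotope]
  refine ⟨fun τ => (finite_extremePoints_cubeFiber _ _).image _, ?_, ?_⟩
  · rw [integrable_map_equiv]
    simpa [Function.comp_def] using hi
  · rw [integral_map_equiv, ← hcard, ← he]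
    simp

theorem cube_eq_parallelotope (n : ℕ) :
    cube n = parallelotope (WithLp.toLp 2 fun _ => -1)
      (fun i => (2 : ℝ) • EuclideanSpace.basisFun (Fin n) ℝ i) := by
  have h : ∀ t : Fin n → ℝ, ∀ j, ((WithLp.toLp 2 fun _ => -1 : EuclideanSpace ℝ (Fin n)) +
      Fintype.linearCombination ℝ
        (fun i => (2 : ℝ) • EuclideanSpace.basisFun (Fin n) ℝ i) t) j = -1 + 2 * t j := by
    intro t j
    simp [Fintype.linearCombination_apply, mul_comm, Pi.single_apply]
  rw [parallelotope_eq_image]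
  ext x
  constructor
  · intro hx
    refine ⟨fun j => (x j + 1) / 2, ⟨fun j => ?_, fun j => ?_⟩, ?_⟩
    · have := (hx j).1
      simp only [Pi.zero_apply]; linarith
    · have := (hx j).2
      simp only [Pi.one_apply]; linarith
    · ext j
      rw [h]; ring
  · rintro ⟨t, ht, rfl⟩ j
    have h0 : 0 ≤ t j := ht.1 j
    have h1 : t j ≤ 1 := ht.2 j
    rw [h]
    constructor <;> linarith

theorem linearIndependent_two_smul_basisFun (n : ℕ) :
    LinearIndependent ℝ fun i => (2 : ℝ) • EuclideanSpace.basisFun (Fin n) ℝ i := by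
  have := (EuclideanSpace.basisFun (Fin n) ℝ).toBasis.linearIndependent.units_smul
    fun _ => Units.mk0 (2 : ℝ) two_ne_zero
  convert! this using 1

theorem mainTheorem1 (n k : ℕ) (v : Fin k → EuclideanSpace ℝ (Fin n))
    (hunit : ∀ i, ‖v i‖ = 1) (hv : LinearIndependent ℝ v) :
    ((∀ τ : (Submodule.span ℝ (Set.range v))ᗮ,
          (sliceVertices (cube n) (Submodule.span ℝ (Set.range v)) τ).Finite) ∧
        Integrable (fun τ : (Submodule.span ℝ (Set.range v))ᗮ =>
            ((sliceVertices (cube n) (Submodule.span ℝ (Set.range v)) τ).ncard : ℝ))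
          (translationLaw (cube n) (Submodule.span ℝ (Set.range v))) ∧
        ∫ τ : (Submodule.span ℝ (Set.range v))ᗮ,
            ((sliceVertices (cube n) (Submodule.span ℝ (Set.range v)) τ).ncard : ℝ)
          ∂(translationLaw (cube n) (Submodule.span ℝ (Set.range v))) = 2 ^ k) ∧
    (∀ (a : EuclideanSpace ℝ (Fin n)) (w : Fin n → EuclideanSpace ℝ (Fin n)),
      LinearIndependent ℝ w →
        (∀ τ : (Submodule.span ℝ (Set.range v))ᗮ,
          (sliceVertices (parallelotope a w) (Submodule.span ℝ (Set.range v)) τ).Finite) ∧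
        Integrable (fun τ : (Submodule.span ℝ (Set.range v))ᗮ =>
            ((sliceVertices (parallelotope a w) (Submodule.span ℝ (Set.range v)) τ).ncard : ℝ))
          (translationLaw (parallelotope a w) (Submodule.span ℝ (Set.range v))) ∧
        ∫ τ : (Submodule.span ℝ (Set.range v))ᗮ,
            ((sliceVertices (parallelotope a w) (Submodule.span ℝ (Set.range v)) τ).ncard : ℝ)
          ∂(translationLaw (parallelotope a w) (Submodule.span ℝ (Set.range v))) = 2 ^ k) := by
  have hk : Module.finrank ℝ (Submodule.span ℝ (Set.range v)) = k := by
    rw [finrank_span_eq_card hv, Fintype.card_fin]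
  have main := fun a w (hw : LinearIndependent ℝ w) =>
    sliceVertices_parallelotope_finite_integrable_integral (Submodule.span ℝ (Set.range v)) a hw
  rw [hk] at main
  refine ⟨?_, main⟩
  rw [cube_eq_parallelotope]
  exact main _ _ (linearIndependent_two_smul_basisFun n)
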